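/- Let $\Gamma$ be an infinite set with a symmetric weight $\mu_{xy}=\mu_{yx}\ge 0$ on $\Gamma\times\Gamma$, and write $x\sim y$ if $\mu_{xy}>0$ (loops $x \sim x$ are allowed). Assume that the resulting graph is connected and locally uniformly finite, i.e. $\sup_{x}\#\{y: y\sim x\}<\infty$. Put $m(x)=\sum_{y\sim x}\mu_{xy}$, $p(x,y)=\frac{\mu_{xy}}{m(x)m(y)}$, $Pf(x)=\sum_{y\in\Gamma}p(x,y)f(y)m(y)$ and $\Delta=I-P$. For $1\le r<\infty$ let $\|f\|_r=\big(\sum_{x\in\Gamma}|f(x)|^r m(x)\big)^{1/r}$, let $L^r$ be the set of $f:\Gamma\to\mathbb R$ with $\|f\|_r<\infty$, and let $L^\infty$ be the set of bounded functions on $\Gamma$. For a sequence $(u_n)_{n\ge 0}$ of nonnegative functions on $\Gamma$ set $\partial_n u_n=u_{n+1}-u_n$ and, for $q\in(1,2]$, $$N_q u_n = q\,u_n\,[\partial_n+\Delta]u_n-u_n^{2-q}\,[\partial_n+\Delta](u_n^q)$$ (with $u_n^{2-q}=1$ when $q=2$). **Theorem.** Let $q\in(1,2]$. There exists a constant $c>0$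 such that for every nonnegative $f\in L^1\cap L^\infty$: $N_q(P^nf)\ge 0$ on $\Gamma$ for all $n\ge 0$, where $N_q(P^n f)$ denotes $N_q u_n$ for $u_n=P^nf$; the series $\sum_{n\ge 0}N_q(P^nf)(x)$ converges for every $x\in\Gamma$; and the function $$\tilde g_{0,q}f(x)=\Big(\sum_{n\ge 0}N_q(P^nf)(x)\Big)^{1/2}$$ belongs to $L^q$ and satisfies $$\|\tilde g_{0,q}f\|_q\le c\,\|f\|_q .$$ -/

import Mathlib

noncomputable section

/-- A symmetric nonnegative weight on a vertex set; loops (`weight x x > 0`) are allowed. -/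
structure WeightedGraph (Γ : Type*) where
  weight : Γ → Γ → ℝ
  weight_symm : ∀ x y, weight x y = weight y x
  weight_nonneg : ∀ x y, 0 ≤ weight x y

namespace WeightedGraph

variable {Γ : Type*} (G : WeightedGraph Γ)

/-- `x ∼ y` when the weight of `(x, y)` is positive. -/
def Adj (x y : Γ) : Prop := 0 < G.weight x y

/-- Any two vertices are joined by a finite path of successive neighbours. -/
def IsConnected : Prop := ∀ x y, Relation.ReflTransGen G.Adj x y

/-- The number of neighbours of a vertex is uniformly bounded. -/
def IsLocallyUniformlyFinite : Prop :=
  ∃ M₀ : ℕ, ∀ x, {y | G.Adj x y}.encard ≤ (M₀ : ℕ∞)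

/-- The weight `m(x) = ∑_{y ∼ x} μ_{xy}` of a vertex (the other terms `μ_{xy}` vanish). -/
def m (x : Γ) : ℝ := ∑' y, G.weight x y

/-- The Markov kernel `p(x,y) = μ_{xy} / (m(x) m(y))`. -/
def kernel (x y : Γ) : ℝ := G.weight x y / (G.m x * G.m y)

/-- The Markov operator `P f(x) = ∑_y p(x,y) f(y) m(y)`. -/
def P (f : Γ → ℝ) (x : Γ) : ℝ := ∑' y, G.kernel x y * f y * G.m y

/-- The Laplacian `Δ = I - P`. -/
def laplacian (f : Γ → ℝ) (x : Γ) : ℝ := f x - G.P f x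

/-- The discrete heat operator `([∂_n + Δ] u_n)(x)`, where `∂_n u_n = u_{n+1} - u_n`. -/
def heat (u : ℕ → Γ → ℝ) (n : ℕ) (x : Γ) : ℝ :=
  (u (n + 1) x - u n x) + G.laplacian (u n) x

/-- `N_q u_n = q u_n [∂_n + Δ] u_n - u_n^{2-q} [∂_n + Δ] (u_n^q)`, at the point `x`. -/
def Nq (q : ℝ) (u : ℕ → Γ → ℝ) (n : ℕ) (x : Γ) : ℝ :=
  q * u n x * G.heat u n x - u n x ^ (2 - q) * G.heat (fun k y => u k y ^ q) n x

/-- The sequence `n ↦ P^n f`. -/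
def iter (f : Γ → ℝ) (n : ℕ) : Γ → ℝ := G.P^[n] f

/-- The functional `g̃_{0,q} f (x) = (∑_{n ≥ 0} N_q(P^n f)(x))^{1/2}`. -/
def gTilde (q : ℝ) (f : Γ → ℝ) (x : Γ) : ℝ :=
  Real.sqrt (∑' n : ℕ, G.Nq q (G.iter f) n x)

/-- Membership in `L^p(Γ, m)` for finite `p`. -/
def MemL (p : ℝ) (f : Γ → ℝ) : Prop := Summable fun x => |f x| ^ p * G.m x

/-- The norm `‖f‖_p = (∑_x |f(x)|^p m(x))^{1/p}`, meaningful for `f ∈ L^p(Γ, m)`. -/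
def lNorm (p : ℝ) (f : Γ → ℝ) : ℝ := (∑' x, |f x| ^ p * G.m x) ^ (1 / p)

end WeightedGraph

/-- Membership in `L^∞(Γ)`: the function is bounded. -/
def MemLInfty {Γ : Type*} (f : Γ → ℝ) : Prop := BddAbove (Set.range fun x => |f x|)

end

open Finset
open scoped ENNReal

/-! ### Scalar inequalities -/

/-! For `u_n = P^n f` the linear heat term vanishes and `N_q u_n = u_n^(2-q) J_n` with `J_n =
P(u_n^q) - (P u_n)^q`, which is nonnegative by Jensen (`Nq_iter`). Since `P` preserves the integral,
`∑ J_n` telescopes to at most `∫ f^q` (`integral_sum_jensen_le`). The factor `u_n^(2-q)` is at most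
`U^(2-q)`, `U` being the maximal function, and Young's inequality gives `(U^(2-q) ∑ J_n)^(q/2) ≤ U^q
+ ∑ J_n`.

It remains to bound `U` in `L^q`. As in Stein's argument, the maximum of `P^(2n) f` is linearized,
and self-adjointness of `P` turns the result into a pairing with the martingale `P^n f` along the
chain. Doob's inequality is proved for it by induction on time, with the running maximum as a real
parameter (`pairing_le`). All bounds are uniform in the number of terms. -/

theorem mul_rpow_sub_one_le {q x y : ℝ} (hq : 1 < q) (hx : 0 ≤ x) (hy : 0 ≤ y) :
    x * y ^ (q - 1) ≤ y ^ q / 2 + 2 ^ (q - 1) * x ^ q := by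
  have key : ∀ z : ℝ, 0 ≤ z → z ^ q = z * z ^ (q - 1) := fun z hz => by
    rw [← Real.rpow_one_add' hz (by linarith)]; ring_nf
  have h2 : (0 : ℝ) ≤ 2 ^ (q - 1) := by positivity
  -- The split at `y = 2x` gives the coefficient `1/2`, small enough for later absorption.
  rcases le_total (2 * x) y with h | h
  · have := mul_le_mul_of_nonneg_right h (Real.rpow_nonneg hy (q - 1))
    have h3 := mul_nonneg h2 (Real.rpow_nonneg hx q)
    rw [key y hy]; linarith
  · have h1 : y ^ (q - 1) ≤ 2 ^ (q - 1) * x ^ (q - 1) := by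
      rw [← Real.mul_rpow (by norm_num) hx]
      exact Real.rpow_le_rpow hy h (by linarith)
    have h3 := mul_le_mul_of_nonneg_left h1 hx
    have h4 := Real.rpow_nonneg hy q
    rw [key x hx]; linarith

/-- The elementary inequality behind Doob's `L^q` maximal inequality: raising the running maximum
from `a` to `max a v` does not increase `a ^ q - q / (q - 1) * v * a ^ (q - 1)`. -/
theorem max_rpow_sub_le {q a v : ℝ} (hq : 1 < q) (ha : 0 ≤ a) (hv : 0 ≤ v) :
    max a v ^ q - q / (q - 1) * v * max a v ^ (q - 1)
      ≤ a ^ q - q / (q - 1) * v * a ^ (q - 1) := by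
  rcases le_total v a with h | h
  · rw [max_eq_left h]
  rw [max_eq_right h]
  have hq0 : 0 < q := by linarith
  have hq1 : 0 < q - 1 := by linarith
  have key : v ^ q = v * v ^ (q - 1) := by
    rw [← Real.rpow_one_add' hv (by linarith)]; ring_nf
  have hy := Real.geom_mean_le_arith_mean2_weighted (w₁ := 1 / q) (w₂ := (q - 1) / q)
    (p₁ := v ^ q) (p₂ := a ^ q) (by positivity) (by positivity)
    (Real.rpow_nonneg hv q) (Real.rpow_nonneg ha q) (by field_simp; ring)
  rw [← Real.rpow_mul hv, ← Real.rpow_mul ha, mul_one_div_cancel hq0.ne', Real.rpow_one,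
    mul_div_cancel₀ _ hq0.ne'] at hy
  have h1 : q / (q - 1) * v * a ^ (q - 1) ≤ v ^ q / (q - 1) + a ^ q := by
    have := mul_le_mul_of_nonneg_left hy (show 0 ≤ q / (q - 1) by positivity)
    calc _ = q / (q - 1) * (v * a ^ (q - 1)) := by ring
      _ ≤ _ := this
      _ = _ := by field_simp
  have h2 : q / (q - 1) * v * v ^ (q - 1) = v ^ q + v ^ q / (q - 1) := by
    rw [mul_assoc, ← key]; field_simp; ring
  linarith

/-- Terminal step of the induction in `pairing_le`. The product is split into `A^q / 2` and a
multiple of `b^q`; a second split gives `b^q ≤ 2 (b^q - q/(q-1) f b^(q-1))` plus a multiple of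
`f^q`, and `max_rpow_sub_le` replaces `b` by `a`. -/
theorem mul_rpow_sub_one_le_max {q a f A b : ℝ} (hq : 1 < q) (ha : 0 ≤ a) (hf : 0 ≤ f)
    (hA : 0 ≤ A) (hb : b = max a f) :
    b * A ^ (q - 1) ≤ 1 / 2 * A ^ q + 2 * (2 ^ (q - 1)) ^ 2 * (q / (q - 1)) ^ q * f ^ q
      + 2 * 2 ^ (q - 1) * (a ^ q - q / (q - 1) * f * a ^ (q - 1)) := by
  have hb0 : 0 ≤ b := hb ▸ le_max_of_le_left ha
  have hc : 0 ≤ q / (q - 1) := div_nonneg (by linarith) (by linarith)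
  have h1 := mul_rpow_sub_one_le hq hb0 hA
  have h2 := mul_rpow_sub_one_le hq (mul_nonneg hc hf) hb0
  rw [Real.mul_rpow hc hf] at h2
  have h3 := max_rpow_sub_le hq ha hf
  rw [← hb] at h3
  have hD : (0 : ℝ) ≤ 2 ^ (q - 1) := by positivity
  have h4 : b ^ q ≤ 2 * (a ^ q - q / (q - 1) * f * a ^ (q - 1))
      + 2 * (2 ^ (q - 1) * ((q / (q - 1)) ^ q * f ^ q)) := by linarith
  have h5 := mul_le_mul_of_nonneg_left h4 hD
  linarith

theorem rpow_half_le_rpow_add {q U J T : ℝ} (hq1 : 1 < q) (hq2 : q ≤ 2) (hU : 0 ≤ U) (hJ : 0 ≤ J)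
    (hT : 0 ≤ T) (h : T ≤ U ^ (2 - q) * J) : T ^ (q / 2) ≤ U ^ q + J := by
  have h1 : T ^ (q / 2) ≤ (U ^ (2 - q) * J) ^ (q / 2) := Real.rpow_le_rpow hT h (by linarith)
  have hy := Real.geom_mean_le_arith_mean2_weighted (w₁ := 1 - q / 2) (w₂ := q / 2)
    (p₁ := U ^ q) (p₂ := J) (by linarith) (by linarith) (Real.rpow_nonneg hU q) hJ (by ring)
  rw [Real.mul_rpow (Real.rpow_nonneg hU _) hJ, ← Real.rpow_mul hU] at h1
  rw [← Real.rpow_mul hU] at hy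
  have e : q * (1 - q / 2) = (2 - q) * (q / 2) := by ring
  rw [e] at hy
  have := Real.rpow_nonneg hU q
  nlinarith

namespace WeightedGraph

variable {Γ : Type*} {G : WeightedGraph Γ}

/-! ### The Markov operator -/

/-- Rows of the weight are finitely supported and have positive mass. -/
structure IsMarkov (G : WeightedGraph Γ) : Prop where
  finite_support : ∀ x, (Function.support (G.weight x)).Finite
  m_pos : ∀ x, 0 < G.m x

theorem IsConnected.isMarkov [Infinite Γ] (hconn : G.IsConnected)
    (hfin : G.IsLocallyUniformlyFinite) : G.IsMarkov := by
  have hs : ∀ x, (Function.support (G.weight x)).Finite := fun x => by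
    obtain ⟨M, hM⟩ := hfin
    have : {y | G.Adj x y}.Finite :=
      Set.finite_of_encard_le_coe (hM x)
    exact this.subset fun y hy => lt_of_le_of_ne (G.weight_nonneg x y) (Ne.symm hy)
  refine ⟨hs, fun x => ?_⟩
  obtain ⟨z, hz⟩ := exists_ne x
  obtain h | ⟨y, hy, -⟩ := (hconn x z).cases_head
  · exact absurd h.symm hz
  · exact (summable_of_hasFiniteSupport (hs x)).tsum_pos (G.weight_nonneg x) y hy

namespace IsMarkov

/-- The finite set of neighbours. -/
noncomputable def nbrs (h : G.IsMarkov) (x : Γ) : Finset Γ := (h.finite_support x).toFinset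

theorem weight_eq_zero (h : G.IsMarkov) {x y : Γ} (hy : y ∉ h.nbrs x) : G.weight x y = 0 := by
  simpa [nbrs] using hy

theorem P_apply (h : G.IsMarkov) (f : Γ → ℝ) (x : Γ) :
    G.P f x = ∑ y ∈ h.nbrs x, G.weight x y / G.m x * f y := by
  unfold P
  rw [tsum_eq_sum (s := h.nbrs x)]
  · refine sum_congr rfl fun y _ => ?_
    have := (h.m_pos y).ne'
    have := (h.m_pos x).ne'
    unfold kernel
    field_simp
  · intro y hy
    simp [kernel, h.weight_eq_zero hy]

theorem prob_nonneg (h : G.IsMarkov) (x y : Γ) : 0 ≤ G.weight x y / G.m x :=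
  div_nonneg (G.weight_nonneg x y) (h.m_pos x).le

theorem sum_prob (h : G.IsMarkov) (x : Γ) : ∑ y ∈ h.nbrs x, G.weight x y / G.m x = 1 := by
  rw [← sum_div, div_eq_one_iff_eq (h.m_pos x).ne']
  exact (tsum_eq_sum fun y hy => h.weight_eq_zero hy).symm

theorem P_mono (h : G.IsMarkov) {f g : Γ → ℝ} (hfg : ∀ x, f x ≤ g x) (x : Γ) :
    G.P f x ≤ G.P g x := by
  rw [h.P_apply, h.P_apply]
  exact sum_le_sum fun y _ => mul_le_mul_of_nonneg_left (hfg y) (h.prob_nonneg x y)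

theorem P_add (h : G.IsMarkov) (f g : Γ → ℝ) : G.P (f + g) = G.P f + G.P g := by
  ext x
  simp [h.P_apply, mul_add, sum_add_distrib]

theorem P_smul (h : G.IsMarkov) (c : ℝ) (f : Γ → ℝ) : G.P (c • f) = c • G.P f := by
  ext x
  simp [h.P_apply, mul_sum, mul_left_comm]

theorem P_const (h : G.IsMarkov) (c : ℝ) : G.P (fun _ => c) = fun _ => c := by
  ext x
  rw [h.P_apply, ← sum_mul, h.sum_prob, one_mul]

theorem P_nonneg (h : G.IsMarkov) {f : Γ → ℝ} (hf : ∀ x, 0 ≤ f x) (x : Γ) : 0 ≤ G.P f x := by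
  simpa [h.P_const] using h.P_mono hf x

theorem rpow_P_le (h : G.IsMarkov) {q : ℝ} (hq : 1 ≤ q) {f : Γ → ℝ} (hf : ∀ x, 0 ≤ f x) (x : Γ) :
    G.P f x ^ q ≤ G.P (fun y => f y ^ q) x := by
  rw [h.P_apply, h.P_apply]
  exact Real.rpow_arith_mean_le_arith_mean_rpow _ _ _ (fun y _ => h.prob_nonneg x y)
    (h.sum_prob x) (fun y _ => hf y) hq

theorem iterate_nonneg (h : G.IsMarkov) {f : Γ → ℝ} (hf : ∀ x, 0 ≤ f x) (n : ℕ) (x : Γ) :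
    0 ≤ G.P^[n] f x := by
  induction n generalizing x with
  | zero => exact hf x
  | succ n ih => rw [Function.iterate_succ_apply']; exact h.P_nonneg ih x

theorem iterate_add (h : G.IsMarkov) (n : ℕ) (f g : Γ → ℝ) :
    G.P^[n] (f + g) = G.P^[n] f + G.P^[n] g := by
  induction n with
  | zero => rfl
  | succ n ih => simp only [Function.iterate_succ_apply', ih, h.P_add]

end IsMarkov

/-! ### Integration of nonnegative functions -/

/-- The integral of a nonnegative function against the vertex weights, with values in `[0, ∞]`. -/
noncomputable def integral (G : WeightedGraph Γ) (f : Γ → ℝ) : ℝ≥0∞ := ∑' x, ENNReal.ofReal (f x * G.m x)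

namespace IsMarkov

theorem integral_mono (h : G.IsMarkov) {f g : Γ → ℝ} (hfg : ∀ x, f x ≤ g x) :
    G.integral f ≤ G.integral g :=
  ENNReal.tsum_le_tsum fun x =>
    ENNReal.ofReal_le_ofReal (mul_le_mul_of_nonneg_right (hfg x) (h.m_pos x).le)

theorem integral_add (h : G.IsMarkov) {f g : Γ → ℝ} (hf : ∀ x, 0 ≤ f x) (hg : ∀ x, 0 ≤ g x) :
    G.integral (fun x => f x + g x) = G.integral f + G.integral g := by
  unfold integral
  rw [← ENNReal.tsum_add]
  refine tsum_congr fun x => ?_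
  rw [add_mul, ENNReal.ofReal_add (mul_nonneg (hf x) (h.m_pos x).le)
    (mul_nonneg (hg x) (h.m_pos x).le)]

theorem integral_const_mul {c : ℝ} (hc : 0 ≤ c) (f : Γ → ℝ) :
    G.integral (fun x => c * f x) = ENNReal.ofReal c * G.integral f := by
  unfold integral
  rw [← ENNReal.tsum_mul_left]
  exact tsum_congr fun x => by rw [mul_assoc, ENNReal.ofReal_mul hc]

theorem integral_sum (h : G.IsMarkov) {ι : Type*} (s : Finset ι) {f : ι → Γ → ℝ}
    (hf : ∀ i x, 0 ≤ f i x) :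
    G.integral (fun x => ∑ i ∈ s, f i x) = ∑ i ∈ s, G.integral (f i) := by
  classical
  induction s using Finset.induction_on with
  | empty => simp [integral]
  | insert a s ha ih =>
    simp only [sum_insert ha]
    rw [h.integral_add (hf a) (fun x => sum_nonneg fun i _ => hf i x), ih]

/-- Both sides are the double sum of `μ_xy g(x) f(y)`, and `μ` is symmetric. -/
theorem integral_mul_P (h : G.IsMarkov) {f g : Γ → ℝ} (hf : ∀ x, 0 ≤ f x) (hg : ∀ x, 0 ≤ g x) :
    G.integral (fun x => g x * G.P f x) = G.integral (fun x => G.P g x * f x) := by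
  have key : ∀ {f g : Γ → ℝ}, (∀ x, 0 ≤ f x) → (∀ x, 0 ≤ g x) →
      G.integral (fun x => g x * G.P f x)
        = ∑' x, ∑' y, ENNReal.ofReal (G.weight x y * (g x * f y)) := fun {f g} hf hg => by
    refine tsum_congr fun x => ?_
    rw [tsum_eq_sum (s := h.nbrs x) fun y hy => by simp [h.weight_eq_zero hy],
      ← ENNReal.ofReal_sum_of_nonneg fun y _ =>
        mul_nonneg (G.weight_nonneg x y) (mul_nonneg (hg x) (hf y))]
    congr 1
    simp only [h.P_apply, mul_sum, sum_mul]
    refine sum_congr rfl fun y _ => ?_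
    have := (h.m_pos x).ne'
    field_simp
  simp_rw [mul_comm (G.P g _)]
  rw [key hf hg, key hg hf, ENNReal.tsum_comm]
  refine tsum_congr fun x => tsum_congr fun y => ?_
  rw [G.weight_symm x y, mul_comm (g y)]

theorem integral_P (h : G.IsMarkov) {f : Γ → ℝ} (hf : ∀ x, 0 ≤ f x) :
    G.integral (G.P f) = G.integral f := by
  simpa [h.P_const] using h.integral_mul_P hf (g := fun _ => 1) (fun _ => zero_le_one)

theorem integral_iterate (h : G.IsMarkov) {f : Γ → ℝ} (hf : ∀ x, 0 ≤ f x) (n : ℕ) :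
    G.integral (G.P^[n] f) = G.integral f := by
  induction n with
  | zero => rfl
  | succ n ih => rw [Function.iterate_succ_apply', h.integral_P (h.iterate_nonneg hf n), ih]

theorem integral_mul_iterate (h : G.IsMarkov) (n : ℕ) {f g : Γ → ℝ} (hf : ∀ x, 0 ≤ f x)
    (hg : ∀ x, 0 ≤ g x) :
    G.integral (fun x => g x * G.P^[n] f x) = G.integral (fun x => G.P^[n] g x * f x) := by
  induction n generalizing g with
  | zero => rfl
  | succ n ih =>
    simp only [Function.iterate_succ_apply' G.P n f, Function.iterate_succ_apply G.P n g]
    rw [h.integral_mul_P (h.iterate_nonneg hf n) hg, ih (h.P_nonneg hg)]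

theorem integral_rpow_P_le (h : G.IsMarkov) {q : ℝ} (hq : 1 ≤ q) {f : Γ → ℝ} (hf : ∀ x, 0 ≤ f x) :
    G.integral (fun x => G.P f x ^ q) ≤ G.integral (fun x => f x ^ q) :=
  (h.integral_mono (h.rpow_P_le hq hf)).trans_eq
    (h.integral_P fun x => Real.rpow_nonneg (hf x) q)

theorem integral_rpow_iterate_le (h : G.IsMarkov) {q : ℝ} (hq : 1 ≤ q) {f : Γ → ℝ}
    (hf : ∀ x, 0 ≤ f x) (n : ℕ) :
    G.integral (fun x => G.P^[n] f x ^ q) ≤ G.integral (fun x => f x ^ q) := by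
  induction n with
  | zero => rfl
  | succ n ih =>
    simp only [Function.iterate_succ_apply']
    exact (h.integral_rpow_P_le hq (h.iterate_nonneg hf n)).trans ih

/-! ### The maximal inequality -/

/-- The sums `∑_{n ≤ j} P^{j-n} (P^n f · P^n g_n)`. -/
noncomputable def pairing (G : WeightedGraph Γ) (f : Γ → ℝ) (g : ℕ → Γ → ℝ) : ℕ → Γ → ℝ
  | 0 => f * g 0
  | j + 1 => G.P (pairing G f g j) + G.P^[j + 1] f * G.P^[j + 1] (g (j + 1))

theorem pairing_nonneg (h : G.IsMarkov) {f : Γ → ℝ} {g : ℕ → Γ → ℝ} (hf : ∀ x, 0 ≤ f x)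
    (hg : ∀ n x, 0 ≤ g n x) (j : ℕ) (x : Γ) : 0 ≤ pairing G f g j x := by
  induction j generalizing x with
  | zero => exact mul_nonneg (hf x) (hg 0 x)
  | succ j ih =>
    exact add_nonneg (h.P_nonneg ih x)
      (mul_nonneg (h.iterate_nonneg hf _ x) (h.iterate_nonneg (hg _) _ x))

/-- The outer `P^(j-n)` preserves the integral, and self-adjointness moves half of `P^(2n)` from `f`
to `g n`; this is why even powers appear. -/
theorem integral_pairing (h : G.IsMarkov) {f : Γ → ℝ} {g : ℕ → Γ → ℝ} (hf : ∀ x, 0 ≤ f x)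
    (hg : ∀ n x, 0 ≤ g n x) (j : ℕ) :
    G.integral (pairing G f g j)
      = ∑ n ∈ range (j + 1), G.integral (fun x => g n x * G.P^[2 * n] f x) := by
  induction j with
  | zero => simp [pairing, integral, mul_comm]
  | succ j ih =>
    rw [sum_range_succ, ← ih, ← h.integral_P (h.pairing_nonneg hf hg j), two_mul]
    simp only [Function.iterate_add_apply G.P (j + 1) (j + 1) f]
    rw [h.integral_mul_iterate _ (h.iterate_nonneg hf _) (hg _),
      ← h.integral_add (h.P_nonneg (h.pairing_nonneg hf hg j))
        fun x => mul_nonneg (h.iterate_nonneg (hg _) _ x) (h.iterate_nonneg hf _ x)]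
    congr 1
    ext x
    simp [pairing, mul_comm]

/-- Doob's maximal inequality along the reversed Markov chain, in the form of a bound with
running maximum `a`. -/
theorem pairing_le (h : G.IsMarkov) {q : ℝ} (hq : 1 < q) {f A : Γ → ℝ} {g : ℕ → Γ → ℝ}
    (hf : ∀ x, 0 ≤ f x) (hA : ∀ x, 0 ≤ A x) (hg : ∀ n x, 0 ≤ g n x)
    (hgA : ∀ j x, ∑ n ∈ range (j + 1), g n x ≤ A x ^ (q - 1)) (j : ℕ) (a : ℝ) (ha : 0 ≤ a)
    (x : Γ) :
    a * G.P^[j] (fun y => A y ^ (q - 1) - ∑ n ∈ range (j + 1), g n y) x + pairing G f g j x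
      ≤ G.P^[j] (fun y => 1 / 2 * A y ^ q
            + 2 * (2 ^ (q - 1)) ^ 2 * (q / (q - 1)) ^ q * f y ^ q) x
        + 2 * 2 ^ (q - 1) * (a ^ q - q / (q - 1) * G.P^[j] f x * a ^ (q - 1)) := by
  have hD : (0 : ℝ) ≤ 2 * 2 ^ (q - 1) := by positivity
  induction j generalizing a x with
  | zero =>
    refine le_trans ?_ (mul_rpow_sub_one_le_max hq ha (hf x) (hA x) rfl)
    have h0 := hg 0 x
    have h1 := hgA 0 x
    simp only [zero_add, range_one, sum_singleton] at h1
    simp only [Function.iterate_zero, id, zero_add, range_one, sum_singleton, pairing,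
      Pi.mul_apply]
    have h2 := mul_le_mul_of_nonneg_right (le_max_left a (f x)) (sub_nonneg.2 h1)
    have h3 := mul_le_mul_of_nonneg_right (le_max_right a (f x)) h0
    linarith
  | succ j ih =>
    set v := G.P^[j + 1] f x with hv
    set b := max a v
    have hb : 0 ≤ b := le_max_of_le_left ha
    -- The running maximum is updated by the current martingale value `v`, and the induction
    -- hypothesis at `b` is averaged over one step of the chain.
    have hstep := h.P_mono (ih b hb) x
    set H : Γ → ℝ := fun y => A y ^ (q - 1) - ∑ n ∈ range (j + 1 + 1), g n y with hH
    set F : Γ → ℝ := fun y => 1 / 2 * A y ^ q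
            + 2 * (2 ^ (q - 1)) ^ 2 * (q / (q - 1)) ^ q * f y ^ q
    have hsplit : (fun y => A y ^ (q - 1) - ∑ n ∈ range (j + 1), g n y) = H + g (j + 1) := by
      ext y
      simp only [hH, Pi.add_apply]
      rw [sum_range_succ _ (j + 1)]
      ring
    have hl : G.P (fun y => b * G.P^[j] (fun y => A y ^ (q - 1) - ∑ n ∈ range (j + 1), g n y) y
        + pairing G f g j y) x
        = b * (G.P^[j + 1] H x + G.P^[j + 1] (g (j + 1)) x) + G.P (pairing G f g j) x := by
      have : (fun y => b * G.P^[j] (fun y => A y ^ (q - 1) - ∑ n ∈ range (j + 1), g n y) y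
        + pairing G f g j y) = b • (G.P^[j] H + G.P^[j] (g (j + 1))) + pairing G f g j := by
        ext y; rw [hsplit, h.iterate_add]; rfl
      rw [this, h.P_add, h.P_smul, h.P_add]
      simp only [Function.iterate_succ_apply']; rfl
    have hr : G.P (fun y => G.P^[j] F y
        + 2 * 2 ^ (q - 1) * (b ^ q - q / (q - 1) * G.P^[j] f y * b ^ (q - 1))) x
        = G.P^[j + 1] F x + 2 * 2 ^ (q - 1) * (b ^ q - q / (q - 1) * v * b ^ (q - 1)) := by
      have : (fun y => G.P^[j] F y
        + 2 * 2 ^ (q - 1) * (b ^ q - q / (q - 1) * G.P^[j] f y * b ^ (q - 1)))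
        = (G.P^[j] F + fun _ => 2 * 2 ^ (q - 1) * b ^ q)
          + (-(2 * 2 ^ (q - 1) * (q / (q - 1) * b ^ (q - 1)))) • G.P^[j] f := by
        ext y; simp only [Pi.add_apply, Pi.smul_apply, smul_eq_mul]; ring
      rw [this, h.P_add, h.P_smul, h.P_add, h.P_const]
      simp only [hv, Function.iterate_succ_apply', Pi.add_apply, Pi.smul_apply, smul_eq_mul]
      ring
    rw [hl, hr] at hstep
    have hH0 : 0 ≤ G.P^[j + 1] H x := h.iterate_nonneg (fun y => sub_nonneg.2 (hgA _ y)) _ x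
    have hg0 : 0 ≤ G.P^[j + 1] (g (j + 1)) x := h.iterate_nonneg (hg _) _ x
    -- The mass `g (j + 1)` is charged at `v ≤ b`, the mass not yet assigned at `a ≤ b`.
    have h1 := mul_le_mul_of_nonneg_right (le_max_left a v) hH0
    have h2 := mul_le_mul_of_nonneg_right (le_max_right a v) hg0
    have h3 := mul_le_mul_of_nonneg_left
      (max_rpow_sub_le hq ha (h.iterate_nonneg hf (j + 1) x)) hD
    have h4 : pairing G f g (j + 1) x
      = G.P (pairing G f g j) x + v * G.P^[j + 1] (g (j + 1)) x := rfl
    rw [h4]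
    linarith

/-- The maximal inequality for the even powers of a symmetric Markov operator. -/
theorem exists_maximal (h : G.IsMarkov) {q : ℝ} (hq : 1 < q) {f : Γ → ℝ} (hf : ∀ x, 0 ≤ f x)
    (hfq : G.integral (fun x => f x ^ q) ≠ ∞) (N : ℕ) :
    ∃ A : Γ → ℝ, (∀ x, 0 ≤ A x) ∧ (∀ n ≤ N, ∀ x, G.P^[2 * n] f x ≤ A x) ∧
      G.integral (fun x => A x ^ q)
        ≤ ENNReal.ofReal (4 * (2 ^ (q - 1)) ^ 2 * (q / (q - 1)) ^ q)
          * G.integral (fun x => f x ^ q) := by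
  have hc : 0 ≤ q / (q - 1) := div_nonneg (by linarith) (by linarith)
  have hex : ∀ x, ∃ n ∈ range (N + 1), ∀ k ∈ range (N + 1), G.P^[2 * k] f x ≤ G.P^[2 * n] f x :=
    fun x => exists_max_image _ _ ⟨0, by simp⟩
  choose ν hν hmax using hex
  set A : Γ → ℝ := fun x => G.P^[2 * ν x] f x with hAdef
  have hA : ∀ x, 0 ≤ A x := fun x => h.iterate_nonneg hf _ x
  refine ⟨A, hA, fun n hn x => hmax x n (by simpa [Nat.lt_succ_iff] using hn), ?_⟩
  -- Linearization: all of `A^(q-1)` sits at the index attaining the maximum, so `∑ g_n P^(2n) f =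
  -- A^q`.
  set g : ℕ → Γ → ℝ := fun n x => if ν x = n then A x ^ (q - 1) else 0 with hgdef
  have hA1 : ∀ x, 0 ≤ A x ^ (q - 1) := fun x => Real.rpow_nonneg (hA x) _
  have hAq : ∀ x, 0 ≤ A x ^ q := fun x => Real.rpow_nonneg (hA x) _
  have hg : ∀ n x, 0 ≤ g n x := fun n x => by
    simp only [hgdef]; split_ifs; exacts [hA1 x, le_rfl]
  have hgA : ∀ j x, ∑ n ∈ range (j + 1), g n x ≤ A x ^ (q - 1) := fun j x => by
    simp only [hgdef, sum_ite_eq]; split_ifs; exacts [le_rfl, hA1 x]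
  -- A priori finiteness, from having finitely many `n`, allows `1/2 ∫ A^q` to be absorbed below.
  have hfin : G.integral (fun x => A x ^ q) ≠ ∞ := by
    have h1 : G.integral (fun x => A x ^ q)
        ≤ ∑ n ∈ range (N + 1), G.integral (fun x => G.P^[2 * n] f x ^ q) := by
      rw [← h.integral_sum _ fun n x => Real.rpow_nonneg (h.iterate_nonneg hf _ x) q]
      exact h.integral_mono fun x => single_le_sum
        (f := fun n => G.P^[2 * n] f x ^ q)
        (fun n _ => Real.rpow_nonneg (h.iterate_nonneg hf _ x) q) (hν x)
    refine ne_top_of_le_ne_top (ENNReal.sum_ne_top.2 fun n _ => ?_) h1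
    exact ne_top_of_le_ne_top hfq (h.integral_rpow_iterate_le hq.le hf _)
  have hpair : G.integral (pairing G f g N) = G.integral (fun x => A x ^ q) := by
    rw [h.integral_pairing hf hg,
      ← h.integral_sum _ fun n x => mul_nonneg (hg n x) (h.iterate_nonneg hf _ x)]
    congr 1
    ext x
    simp only [hgdef, ite_mul, zero_mul, sum_ite_eq, if_pos (hν x)]
    change A x ^ (q - 1) * A x = _
    nth_rewrite 2 [← Real.rpow_one (A x)]
    rw [← Real.rpow_add' (hA x) (by linarith)]
    ring_nf
  set C : ℝ := 2 * (2 ^ (q - 1)) ^ 2 * (q / (q - 1)) ^ q with hC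
  have hC0 : 0 ≤ C := by positivity
  have hle : G.integral (fun x => A x ^ q)
      ≤ ENNReal.ofReal (1 / 2) * G.integral (fun x => A x ^ q)
        + ENNReal.ofReal C * G.integral (fun x => f x ^ q) := by
    have hfq0 : ∀ x, 0 ≤ C * f x ^ q := fun x => mul_nonneg hC0 (Real.rpow_nonneg (hf x) q)
    have hAq0 : ∀ x, 0 ≤ 1 / 2 * A x ^ q := fun x => mul_nonneg (by norm_num) (hAq x)
    calc G.integral (fun x => A x ^ q) = G.integral (pairing G f g N) := hpair.symm
      _ ≤ G.integral (G.P^[N] fun x => 1 / 2 * A x ^ q + C * f x ^ q) := by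
        refine h.integral_mono fun x => ?_
        have := h.pairing_le hq hf hA hg hgA N 0 le_rfl x
        simpa [Real.zero_rpow (by linarith : q ≠ 0), Real.zero_rpow (by linarith : q - 1 ≠ 0)]
          using this
      _ = G.integral (fun x => 1 / 2 * A x ^ q + C * f x ^ q) :=
        h.integral_iterate (fun x => add_nonneg (hAq0 x) (hfq0 x)) N
      _ = _ := by
        rw [h.integral_add hAq0 hfq0, integral_const_mul (by norm_num), integral_const_mul hC0]
  rw [← ENNReal.ofReal_toReal hfin, ← ENNReal.ofReal_toReal hfq] at hle ⊢
  have hI := @ENNReal.toReal_nonneg (G.integral fun x => A x ^ q)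
  have hJ := @ENNReal.toReal_nonneg (G.integral fun x => f x ^ q)
  rw [← ENNReal.ofReal_mul (by norm_num), ← ENNReal.ofReal_mul hC0,
    ← ENNReal.ofReal_add (by positivity) (by positivity),
    ENNReal.ofReal_le_ofReal_iff (by positivity)] at hle
  rw [← ENNReal.ofReal_mul (by positivity)]
  refine ENNReal.ofReal_le_ofReal ?_
  have : 4 * (2 ^ (q - 1)) ^ 2 * (q / (q - 1)) ^ q = 2 * C := by rw [hC]; ring
  rw [this]
  linarith

/-! ### The Littlewood-Paley functional -/

theorem Nq_iter (f : Γ → ℝ) (q : ℝ) (n : ℕ) (x : Γ) :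
    G.Nq q (G.iter f) n x = G.P^[n] f x ^ (2 - q)
      * (G.P (fun y => G.P^[n] f y ^ q) x - G.P^[n + 1] f x ^ q) := by
  simp only [Nq, heat, laplacian, iter, Function.iterate_succ_apply']
  ring

theorem jensen_nonneg (h : G.IsMarkov) {q : ℝ} (hq : 1 ≤ q) {f : Γ → ℝ} (hf : ∀ x, 0 ≤ f x)
    (n : ℕ) (x : Γ) : 0 ≤ G.P (fun y => G.P^[n] f y ^ q) x - G.P^[n + 1] f x ^ q := by
  rw [Function.iterate_succ_apply']
  exact sub_nonneg.2 (h.rpow_P_le hq (h.iterate_nonneg hf n) x)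

theorem Nq_iter_nonneg (h : G.IsMarkov) {q : ℝ} (hq : 1 ≤ q) {f : Γ → ℝ} (hf : ∀ x, 0 ≤ f x)
    (n : ℕ) (x : Γ) : 0 ≤ G.Nq q (G.iter f) n x := by
  rw [Nq_iter]
  exact mul_nonneg (Real.rpow_nonneg (h.iterate_nonneg hf n x) _) (h.jensen_nonneg hq hf n x)

theorem integral_sum_jensen_le (h : G.IsMarkov) {q : ℝ} (hq : 1 ≤ q) {f : Γ → ℝ}
    (hf : ∀ x, 0 ≤ f x) (N : ℕ) :
    G.integral (fun x => ∑ n ∈ range N,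
      (G.P (fun y => G.P^[n] f y ^ q) x - G.P^[n + 1] f x ^ q))
      ≤ G.integral (fun x => f x ^ q) := by
  have hn : ∀ n x, 0 ≤ G.P^[n] f x ^ q := fun n x => Real.rpow_nonneg (h.iterate_nonneg hf n x) q
  rw [h.integral_sum _ (h.jensen_nonneg hq hf)]
  -- Keeping the remainder `∫ (P^N f)^q` makes the telescoping an equality without subtraction in
  -- `[0, ∞]`.
  suffices ∑ n ∈ range N, G.integral
      (fun x => G.P (fun y => G.P^[n] f y ^ q) x - G.P^[n + 1] f x ^ q)
      + G.integral (fun x => G.P^[N] f x ^ q) = G.integral (fun x => f x ^ q) from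
    this ▸ le_self_add
  induction N with
  | zero => simp
  | succ N ih =>
    rw [sum_range_succ, add_assoc, ← h.integral_add (h.jensen_nonneg hq hf N) (hn _), ← ih]
    simp only [sub_add_cancel]
    rw [h.integral_P (hn N)]

/-- The constant of the functional bound. -/
noncomputable def gConst (q : ℝ) : ℝ := 2 * (4 * (2 ^ (q - 1)) ^ 2 * (q / (q - 1)) ^ q) + 1

theorem gConst_pos {q : ℝ} (hq : 1 < q) : 0 < gConst q := by
  have hc : 0 ≤ q / (q - 1) := div_nonneg (by linarith) (by linarith)
  unfold gConst
  positivity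

theorem integral_partialSum_le (h : G.IsMarkov) {q : ℝ} (hq1 : 1 < q) (hq2 : q ≤ 2) {f : Γ → ℝ}
    (hf : ∀ x, 0 ≤ f x) (hfq : G.integral (fun x => f x ^ q) ≠ ∞) (N : ℕ) :
    G.integral (fun x => (∑ n ∈ range N, G.Nq q (G.iter f) n x) ^ (q / 2))
      ≤ ENNReal.ofReal (gConst q) * G.integral (fun x => f x ^ q) := by
  have hc : 0 ≤ q / (q - 1) := div_nonneg (by linarith) (by linarith)
  have hP := h.integral_rpow_P_le hq1.le hf
  obtain ⟨A, hA, hAmax, hAq⟩ := h.exists_maximal hq1 hf hfq N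
  -- Odd powers of `P` on `f` are even powers on `P f`.
  obtain ⟨B, hB, hBmax, hBq⟩ := h.exists_maximal hq1 (h.P_nonneg hf)
    (ne_top_of_le_ne_top hfq hP) N
  set J : ℕ → Γ → ℝ := fun n x => G.P (fun y => G.P^[n] f y ^ q) x - G.P^[n + 1] f x ^ q with hJ
  have hJ0 : ∀ n x, 0 ≤ J n x := h.jensen_nonneg hq1.le hf
  have hle : ∀ n ∈ range N, ∀ x, G.P^[n] f x ≤ max (A x) (B x) := fun n hn x => by
    rw [mem_range] at hn
    obtain ⟨k, rfl | rfl⟩ := n.even_or_odd'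
    · exact le_max_of_le_left (hAmax k (by omega) x)
    · exact le_max_of_le_right (hBmax k (by omega) x)
  have hpt : ∀ x, (∑ n ∈ range N, G.Nq q (G.iter f) n x) ^ (q / 2)
      ≤ A x ^ q + B x ^ q + ∑ n ∈ range N, J n x := fun x => by
    have h1 : ∑ n ∈ range N, G.Nq q (G.iter f) n x
        ≤ max (A x) (B x) ^ (2 - q) * ∑ n ∈ range N, J n x := by
      rw [mul_sum]
      refine sum_le_sum fun n hn => ?_
      rw [Nq_iter]
      exact mul_le_mul_of_nonneg_right (Real.rpow_le_rpow (h.iterate_nonneg hf n x)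
        (hle n hn x) (by linarith)) (hJ0 n x)
    have h2 := rpow_half_le_rpow_add hq1 hq2 (le_max_of_le_left (hA x))
      (sum_nonneg fun n _ => hJ0 n x)
      (sum_nonneg fun n _ => h.Nq_iter_nonneg hq1.le hf n x) h1
    have hAx := Real.rpow_nonneg (hA x) q
    have hBx := Real.rpow_nonneg (hB x) q
    rcases max_choice (A x) (B x) with e | e <;> rw [e] at h2 <;> linarith
  refine (h.integral_mono hpt).trans ?_
  rw [h.integral_add (fun x => add_nonneg (Real.rpow_nonneg (hA x) q) (Real.rpow_nonneg (hB x) q))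
    (fun x => sum_nonneg fun n _ => hJ0 n x),
    h.integral_add (fun x => Real.rpow_nonneg (hA x) q) (fun x => Real.rpow_nonneg (hB x) q),
    gConst, ENNReal.ofReal_add (by positivity) zero_le_one, two_mul,
    ENNReal.ofReal_add (by positivity) (by positivity), add_mul, add_mul, ENNReal.ofReal_one,
    one_mul]
  gcongr
  · exact hBq.trans (by gcongr)
  · exact h.integral_sum_jensen_le hq1.le hf N

theorem summable_rpow (h : G.IsMarkov) {q : ℝ} (hq : 1 < q) {f : Γ → ℝ} (hf : ∀ x, 0 ≤ f x)
    (h1 : G.MemL 1 f) (hb : MemLInfty f) : Summable fun x => f x ^ q * G.m x := by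
  obtain ⟨M, hM⟩ := hb
  have hM' : ∀ x, f x ≤ M := fun x => (le_abs_self _).trans (hM ⟨x, rfl⟩)
  refine Summable.of_nonneg_of_le
    (fun x => mul_nonneg (Real.rpow_nonneg (hf x) q) (h.m_pos x).le) (fun x => ?_)
    (h1.mul_left (M ^ (q - 1)))
  rw [Real.rpow_one, abs_of_nonneg (hf x), ← mul_assoc]
  refine mul_le_mul_of_nonneg_right ?_ (h.m_pos x).le
  have : f x ^ q = f x ^ (q - 1) * f x := by
    nth_rewrite 3 [← Real.rpow_one (f x)]
    rw [← Real.rpow_add' (hf x) (by linarith)]; ring_nf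
  rw [this]
  exact mul_le_mul_of_nonneg_right (Real.rpow_le_rpow (hf x) (hM' x) (by linarith)) (hf x)

end IsMarkov

end WeightedGraph

/-! ### Passage to the infinite series -/

theorem mainTheorem3 {Γ : Type*} [Infinite Γ] (G : WeightedGraph Γ)
    (hconn : G.IsConnected) (hfin : G.IsLocallyUniformlyFinite)
    (q : ℝ) (hq1 : 1 < q) (hq2 : q ≤ 2) :
    ∃ c : ℝ, 0 < c ∧ ∀ f : Γ → ℝ, (∀ x, 0 ≤ f x) → G.MemL 1 f → MemLInfty f →
      (∀ n x, 0 ≤ G.Nq q (G.iter f) n x) ∧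
      (∀ x, Summable fun n => G.Nq q (G.iter f) n x) ∧
      G.MemL q (G.gTilde q f) ∧
      G.lNorm q (G.gTilde q f) ≤ c * G.lNorm q f := by
  have h := hconn.isMarkov hfin
  have hK := WeightedGraph.IsMarkov.gConst_pos hq1
  set K := WeightedGraph.IsMarkov.gConst q
  have hq0 : 0 < q := by linarith
  refine ⟨K ^ (1 / q), Real.rpow_pos_of_pos hK _, fun f hf h1 hb => ?_⟩
  have hs := h.summable_rpow hq1 hf h1 hb
  have hf0 : ∀ x, 0 ≤ f x ^ q * G.m x := fun x =>
    mul_nonneg (Real.rpow_nonneg (hf x) q) (h.m_pos x).le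
  have hI : G.integral (fun x => f x ^ q) = ENNReal.ofReal (∑' x, f x ^ q * G.m x) :=
    (ENNReal.ofReal_tsum_of_nonneg hf0 hs).symm
  have hN : ∀ n x, 0 ≤ G.Nq q (G.iter f) n x := h.Nq_iter_nonneg hq1.le hf
  set S := ∑' x, f x ^ q * G.m x with hS
  have hS0 : 0 ≤ S := tsum_nonneg hf0
  set T : ℕ → Γ → ℝ := fun N x => ∑ n ∈ range N, G.Nq q (G.iter f) n x with hT
  have hT0 : ∀ N x, 0 ≤ T N x := fun N x => sum_nonneg fun n _ => hN n x
  have hbound : ∀ N (s : Finset Γ), ∑ x ∈ s, T N x ^ (q / 2) * G.m x ≤ K * S := fun N s => by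
    have h2 := h.integral_partialSum_le hq1 hq2 hf (hI ▸ ENNReal.ofReal_ne_top) N
    rw [hI, ← ENNReal.ofReal_mul hK.le] at h2
    have h3 := (ENNReal.sum_le_tsum s).trans h2
    rw [← ENNReal.ofReal_sum_of_nonneg fun x _ =>
      mul_nonneg (Real.rpow_nonneg (hT0 N x) _) (h.m_pos x).le] at h3
    exact (ENNReal.ofReal_le_ofReal_iff (by positivity)).1 h3
  have hsum : ∀ x, Summable fun n => G.Nq q (G.iter f) n x := fun x => by
    refine summable_of_sum_range_le (c := (K * S / G.m x) ^ (2 / q)) (fun n => hN n x) fun N => ?_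
    -- As `m(x) > 0`, the integral bound at a single vertex already bounds the partial sums.
    have h2 := hbound N {x}
    rw [sum_singleton, ← le_div_iff₀ (h.m_pos x)] at h2
    have h3 := Real.rpow_le_rpow (Real.rpow_nonneg (hT0 N x) _) h2
      (show 0 ≤ 2 / q by positivity)
    rwa [← Real.rpow_mul (hT0 N x), show q / 2 * (2 / q) = 1 by field_simp, Real.rpow_one] at h3
  have hg : ∀ x, |G.gTilde q f x| ^ q = (∑' n, G.Nq q (G.iter f) n x) ^ (q / 2) := fun x => by
    rw [WeightedGraph.gTilde, abs_of_nonneg (Real.sqrt_nonneg _), Real.sqrt_eq_rpow,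
      ← Real.rpow_mul (tsum_nonneg fun n => hN n x)]
    congr 1
    ring
  have hg0 : ∀ x, 0 ≤ |G.gTilde q f x| ^ q * G.m x := fun x =>
    mul_nonneg (Real.rpow_nonneg (abs_nonneg _) q) (h.m_pos x).le
  -- On a finite set of vertices the limit in `N` is taken termwise, so no monotone convergence
  -- theorem is needed.
  have hlim : ∀ s : Finset Γ, ∑ x ∈ s, |G.gTilde q f x| ^ q * G.m x ≤ K * S := fun s => by
    refine le_of_tendsto' (x := Filter.atTop) (f := fun N => ∑ x ∈ s, T N x ^ (q / 2) * G.m x)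
      (tendsto_finsetSum _ fun x _ => ?_) fun N => hbound N s
    rw [hg]
    exact ((hsum x).hasSum.tendsto_sum_nat.rpow_const (Or.inr (by positivity))).mul_const _
  refine ⟨hN, hsum, summable_of_sum_le hg0 hlim, ?_⟩
  have habs : ∑' x, |f x| ^ q * G.m x = S :=
    tsum_congr fun x => by rw [abs_of_nonneg (hf x)]
  rw [WeightedGraph.lNorm, WeightedGraph.lNorm, habs, ← Real.mul_rpow hK.le hS0]
  exact Real.rpow_le_rpow (tsum_nonneg hg0) (Real.tsum_le_of_sum_le hg0 hlim) (by positivity)
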